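/- Let $n\ge 1$ and let $B_{n+1}^+$ be the braid semigroup (with unit) generated by $a_1,\dots,a_n$ subject to $a_{i+1}a_ia_{i+1}=a_ia_{i+1}a_i$ ($1\le i\le n-1$) and $a_sa_k=a_ka_s$ ($s-k\ge 2$). For $j\le i$ put $a_{ij}=a_ia_{i-1}\cdots a_j$, and let $a_{i\,i+1}$ be the empty word. For a word $W$ and $m\ge 0$ let $W^{(m)}$ be the word obtained by replacing every letter $a_k$ of $W$ by $a_{k+m}$; write $W'=W^{(1)}$. Call a word in $a_1,\dots,a_n$ reduced if it contains as a factor no left-hand side (leading word) of a relation of the Gröbner–Shirshov basis of $B_{n+1}^+$ (deg-lex order, $a_1<\dots<a_n$), which consists of the relations $$a_{i+1}a_i\,V\,W\,a_{i+1\,j}=a_ia_{i+1}a_i\,V\,a_{ij}\,W',\qquad 1\le i\le n-1,\ 1\le j\le i+1,$$ where $V$ is any word in $a_1,\dots,a_{i-1}$ and $W$ is any word in $a_j,\dots,a_i$ (empty if $j=i+1$) that is empty or begins with $a_i$, and of the relations $a_sa_k=a_ka_s$, $s-k\ge 2$. Let $\Lambda_i=a_ia_{i-1}\cdots a_1$ and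 let $\Delta=\Lambda_1\Lambda_2\cdots\Lambda_n$ be Garside's fundamental word. Let $v$ be a reduced word in $a_1,\dots,a_n$. Then $v$ is equal in $B_{n+1}^+$ to a word beginning with $\Delta$ if and only if $v$ is, letter by letter, of the form $$v\doteq\Lambda_1V_1\Lambda_2V_2\cdots\Lambda_{n-1}V_{n-1}\Lambda_nu,$$ where each $V_i$ ($1\le i\le n-1$) is a word in $a_1,\dots,a_i$ that is empty or begins with $a_1$, and $u$ is a word in $a_1,\dots,a_n$. Moreover, for every such expression of $v$, the equality $$v=\Delta\,V_1^{(n-1)}V_2^{(n-2)}\cdots V_{n-1}'\,u$$ holds in $B_{n+1}^+$. -/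

import Mathlib

namespace BraidSemigroup

/-- The index (in `{1, …, n}`) of a letter: `x : Fin n` stands for the generator `a_{x + 1}`. -/
def idx {n : ℕ} (x : Fin n) : ℕ := (x : ℕ) + 1

/-- The Artin relations between the generators `a_1, …, a_n`:
`a_{i+1} a_i a_{i+1} = a_i a_{i+1} a_i` and `a_s a_k = a_k a_s` for `s - k ≥ 2`. -/
inductive ArtinRel (n : ℕ) : FreeMonoid (Fin n) → FreeMonoid (Fin n) → Prop
  | braid (x y : Fin n) (h : idx y = idx x + 1) :
      ArtinRel n (FreeMonoid.of y * FreeMonoid.of x * FreeMonoid.of y)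
        (FreeMonoid.of x * FreeMonoid.of y * FreeMonoid.of x)
  | comm (x y : Fin n) (h : idx y + 2 ≤ idx x) :
      ArtinRel n (FreeMonoid.of x * FreeMonoid.of y) (FreeMonoid.of y * FreeMonoid.of x)

/-- The braid semigroup `B_{n+1}^+` (with its unit, the class of the empty word). -/
abbrev BraidMonoid (n : ℕ) : Type := PresentedMonoid (ArtinRel n)

/-- The element of `B_{n+1}^+` represented by a word in `a_1, …, a_n`. -/
def eval {n : ℕ} (w : List (Fin n)) : BraidMonoid n :=
  PresentedMonoid.mk (ArtinRel n) (FreeMonoid.ofList w)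

/-- The descending word `a_i a_{i-1} ⋯ a_j` (for `1 ≤ j` and `i ≤ n`); it is empty if `j > i`. -/
def desc (n i j : ℕ) : List (Fin n) :=
  (List.finRange n).reverse.filter (fun x => j ≤ idx x ∧ idx x ≤ i)

/-- `w` is a word in the letters `a_j, …, a_i` (so `w` is empty if `j > i`). -/
def IsWordIn {n : ℕ} (j i : ℕ) (w : List (Fin n)) : Prop :=
  ∀ x ∈ w, j ≤ idx x ∧ idx x ≤ i

/-- `w` is empty or its first letter is `a_i`. -/
def EmptyOrBeginsWith {n : ℕ} (i : ℕ) (w : List (Fin n)) : Prop :=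
  ∀ x ∈ w.head?, idx x = i

/-- The word obtained from `w` by replacing every letter `a_k` by `a_{k+m}`. (It is only used
for words whose letters `a_k` satisfy `k + m ≤ n`; otherwise a letter is dropped.) -/
def shift {n : ℕ} (m : ℕ) (w : List (Fin n)) : List (Fin n) :=
  w.filterMap (fun x => if h : (x : ℕ) + m < n then some ⟨(x : ℕ) + m, h⟩ else none)

/-- The relations of the Gröbner–Shirshov basis of `B_{n+1}^+` (for the deg-lex order with
`a_1 < ⋯ < a_n`), each written with its leading word on the left:
`a_{i+1} a_i V W a_{i+1} a_i ⋯ a_j = a_i a_{i+1} a_i V a_i a_{i-1} ⋯ a_j W'` with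
`1 ≤ i ≤ n - 1`, `1 ≤ j ≤ i + 1`, `V` a word in `a_1, …, a_{i-1}`, `W` a word in `a_j, …, a_i`
which is empty or begins with `a_i`, and `W'` the shift of `W` by one;
and `a_s a_k = a_k a_s` with `s - k ≥ 2`. -/
inductive BasisRel (n : ℕ) : List (Fin n) → List (Fin n) → Prop
  | chain (i j : ℕ) (V W : List (Fin n)) (hi : 1 ≤ i) (hin : i + 1 ≤ n) (hj : 1 ≤ j)
      (hji : j ≤ i + 1) (hV : IsWordIn 1 (i - 1) V) (hW : IsWordIn j i W)
      (hWi : EmptyOrBeginsWith i W) :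
      BasisRel n (desc n (i + 1) i ++ V ++ W ++ desc n (i + 1) j)
        (desc n i i ++ desc n (i + 1) i ++ V ++ desc n i j ++ shift 1 W)
  | comm (x y : Fin n) (h : idx y + 2 ≤ idx x) : BasisRel n [x, y] [y, x]

/-- A word is reduced (in normal form, an element of the PBW-basis of `B_{n+1}^+`) if it does not
contain the leading word of a relation of the Gröbner–Shirshov basis as a factor. -/
def IsReduced {n : ℕ} (v : List (Fin n)) : Prop :=
  ∀ l r : List (Fin n), BasisRel n l r → ¬ l <:+: v

/-- `Λ_i = a_i a_{i-1} ⋯ a_1`. -/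
def Lam (n i : ℕ) : List (Fin n) := desc n i 1

/-- Garside's fundamental word `Δ = Λ_1 Λ_2 ⋯ Λ_n`. -/
def Delta (n : ℕ) : List (Fin n) := (List.range n).flatMap (fun k => Lam n (k + 1))

/-- Some word beginning with `Δ` is equal to `v` in the braid semigroup. -/
def BeginsWithDelta {n : ℕ} (v : List (Fin n)) : Prop :=
  ∃ w : List (Fin n), eval v = eval (Delta n ++ w)

/-- `v` is literally the word `Λ_1 V_1 Λ_2 V_2 ⋯ Λ_{n-1} V_{n-1} Λ_n u`, where, for
`1 ≤ i ≤ n - 1`, `V_i` is a word in `a_1, …, a_i` which is empty or begins with `a_1`. -/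
def HasGarsideForm {n : ℕ} (v : List (Fin n)) (V : ℕ → List (Fin n)) (u : List (Fin n)) : Prop :=
  (∀ i : ℕ, 1 ≤ i → i ≤ n - 1 → IsWordIn 1 i (V i) ∧ EmptyOrBeginsWith 1 (V i)) ∧
    v = (List.range (n - 1)).flatMap (fun k => Lam n (k + 1) ++ V (k + 1)) ++ Lam n n ++ u

end BraidSemigroup

/-! Everything rests on left divisibility in `B_{n+1}^+`; here `∣` means being a left factor.
Garside's lemma (`lcmForm_of_gen_mul_eq`) gives left cancellation and describes when two generators
divide the same element. From it follows `IsReduced.headMin`: the first letter of a reduced word is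
the smallest generator dividing it, since a smaller divisor would force a leading word of the basis
to occur. Only leading words are used; confluence of the rewriting plays no role.

If `Δ` divides a reduced word, its factors are read off from the left: letters before the next
`Λ_{k+1}` have index at most `k` and cancel without destroying divisibility by the remaining `Λ`s
(`exists_Lam_prefix`). Reducedness also forces each block `V_i` to start with `a_1`. Conversely, a
word in `a_1, …, a_i` passes through `Λ_{i+1}` with all its indices raised by one (`eval_mul_Lam`),
which collects the `Λ`s in front. -/

namespace BraidSemigroup

variable {n : ℕ}

/-! ### Words, elementary rewriting steps and length. -/

/-- The generator of the braid semigroup given by a letter. -/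
def gen (x : Fin n) : BraidMonoid n := eval [x]

@[simp] theorem eval_nil : eval ([] : List (Fin n)) = 1 := rfl

theorem eval_append (u v : List (Fin n)) : eval (u ++ v) = eval u * eval v := rfl

theorem eval_cons (x : Fin n) (v : List (Fin n)) : eval (x :: v) = gen x * eval v := rfl

theorem exists_eval_eq (g : BraidMonoid n) : ∃ w, eval w = g := by
  obtain ⟨w, rfl⟩ := Con.mk'_surjective g
  exact ⟨FreeMonoid.toList w, rfl⟩

/-- The indices of two letters differ by at least `2`. -/
def Far (x y : Fin n) : Prop := (x : ℕ) + 2 ≤ y ∨ (y : ℕ) + 2 ≤ x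

/-- The indices of two letters differ by exactly `1`. -/
def Adj (x y : Fin n) : Prop := (x : ℕ) + 1 = y ∨ (y : ℕ) + 1 = x

theorem Far.symm {x y : Fin n} (h : Far x y) : Far y x := Or.symm h

theorem Adj.symm {x y : Fin n} (h : Adj x y) : Adj y x := Or.symm h

theorem gen_mul_comm {x y : Fin n} (h : Far x y) : gen x * gen y = gen y * gen x := by
  have key : ∀ x y : Fin n, (y : ℕ) + 2 ≤ x → gen x * gen y = gen y * gen x := fun x y h =>
    (Con.eq _).2 (ConGen.Rel.of _ _ (ArtinRel.comm x y (by simp only [idx]; omega)))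
  rcases h with h | h
  · exact (key y x h).symm
  · exact key x y h

theorem gen_braid {x y : Fin n} (h : Adj x y) :
    gen x * gen y * gen x = gen y * gen x * gen y := by
  have key : ∀ x y : Fin n, (x : ℕ) + 1 = y → gen y * gen x * gen y = gen x * gen y * gen x :=
    fun x y h =>
      (Con.eq _).2 (ConGen.Rel.of _ _ (ArtinRel.braid x y (by simp only [idx]; omega)))
  rcases h with h | h
  · exact (key x y h).symm
  · exact key y x h

theorem gen_mul_comm_left {x y : Fin n} (h : Far x y) (t : BraidMonoid n) :
    gen x * (gen y * t) = gen y * (gen x * t) := by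
  rw [← mul_assoc, gen_mul_comm h, mul_assoc]

theorem gen_braid_left {x y : Fin n} (h : Adj x y) (t : BraidMonoid n) :
    gen x * (gen y * (gen x * t)) = gen y * (gen x * (gen y * t)) := by
  have := congrArg (· * t) (gen_braid h)
  simpa only [mul_assoc] using this

/-- The defining relations, read in both directions. -/
inductive ElementaryRel : List (Fin n) → List (Fin n) → Prop
  | comm (x y : Fin n) (h : Far x y) : ElementaryRel [x, y] [y, x]
  | braid (x y : Fin n) (h : Adj x y) : ElementaryRel [x, y, x] [y, x, y]

theorem ElementaryRel.symm {u v : List (Fin n)} (h : ElementaryRel u v) : ElementaryRel v u := by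
  cases h with
  | comm x y h => exact .comm y x h.symm
  | braid x y h => exact .braid y x h.symm

/-- One application of a defining relation inside a word. -/
inductive Step : List (Fin n) → List (Fin n) → Prop
  | head {l r : List (Fin n)} (q : List (Fin n)) (h : ElementaryRel l r) : Step (l ++ q) (r ++ q)
  | cons (x : Fin n) {u v : List (Fin n)} (h : Step u v) : Step (x :: u) (x :: v)

theorem Step.symm {u v : List (Fin n)} (h : Step u v) : Step v u := by
  induction h with
  | head q h => exact .head q h.symm
  | cons x h ih => exact .cons x ih

theorem Step.append_left (p : List (Fin n)) {u v : List (Fin n)} (h : Step u v) :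
    Step (p ++ u) (p ++ v) := by
  induction p with
  | nil => exact h
  | cons x p ih => exact .cons x ih

theorem Step.append_right (q : List (Fin n)) {u v : List (Fin n)} (h : Step u v) :
    Step (u ++ q) (v ++ q) := by
  induction h with
  | head q' h => simpa only [List.append_assoc] using Step.head (q' ++ q) h
  | cons x h ih => exact .cons x ih

theorem ElementaryRel.eval_eq {u v : List (Fin n)} (h : ElementaryRel u v) : eval u = eval v := by
  cases h with
  | comm x y h => exact gen_mul_comm h
  | braid x y h => exact gen_braid h

theorem Step.eval_eq {u v : List (Fin n)} (h : Step u v) : eval u = eval v := by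
  induction h with
  | head q h => rw [eval_append, eval_append, h.eval_eq]
  | cons x h ih => rw [eval_cons, eval_cons, ih]

/-- Turns equality in the quotient into a finite chain of rewrites, on which Garside's lemma can be
proved by induction. -/
theorem reflTransGen_step_of_eval_eq {u v : List (Fin n)} (h : eval u = eval v) :
    Relation.ReflTransGen Step u v := by
  have key : ∀ a b : FreeMonoid (Fin n), ConGen.Rel (ArtinRel n) a b →
      Relation.ReflTransGen Step (FreeMonoid.toList a) (FreeMonoid.toList b) := by
    intro a b hab
    induction hab with
    | of a b hab =>
      refine .single ?_
      cases hab with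
      | braid x y h =>
        exact Step.head [] (.braid y x (Or.inr (by simp only [idx] at h; omega)))
      | comm x y h => exact Step.head [] (.comm x y (Or.inr (by simp only [idx] at h; omega)))
    | refl a => exact .refl
    | symm _ ih => exact (have : Std.Symm (Step (n := n)) := ⟨fun _ _ h => h.symm⟩
      Relation.ReflTransGen.stdSymm.symm _ _ ih)
    | trans _ _ ih₁ ih₂ => exact ih₁.trans ih₂
    | mul _ _ ih₁ ih₂ =>
      exact (ih₁.lift (· ++ _) fun _ _ h => h.append_right _).trans
        (ih₂.lift (_ ++ ·) fun _ _ h => h.append_left _)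
  exact key _ _ ((Con.eq _).1 h)

/-- The word length of an element of the braid semigroup. -/
def len : BraidMonoid n →* Multiplicative ℕ :=
  PresentedMonoid.lift (fun _ => Multiplicative.ofAdd 1) (by
    intro a b h
    cases h <;> simp [← ofAdd_add])

theorem len_eval (w : List (Fin n)) : len (eval w) = Multiplicative.ofAdd w.length := by
  induction w with
  | nil => rfl
  | cons x w ih =>
    rw [eval_cons, map_mul, ih]
    change Multiplicative.ofAdd 1 * _ = _
    rw [← ofAdd_add, List.length_cons, add_comm]

theorem len_gen_mul (x : Fin n) (u : BraidMonoid n) :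
    (len (gen x * u)).toAdd = (len u).toAdd + 1 := by
  rw [map_mul, gen, len_eval, toAdd_mul, add_comm]
  rfl

/-! ### Garside's lemma. -/

/-- The conclusion of Garside's lemma: from `gen x * u = gen y * v` one may cancel a common
letter, or else extract the least common multiple of `gen x` and `gen y`. -/
def LcmForm (x y : Fin n) (u v : BraidMonoid n) : Prop :=
  (x = y ∧ u = v) ∨ (Far x y ∧ ∃ k, u = gen y * k ∧ v = gen x * k) ∨
    (Adj x y ∧ ∃ k, u = gen y * (gen x * k) ∧ v = gen x * (gen y * k))

theorem LcmForm.symm {x y : Fin n} {u v : BraidMonoid n} (h : LcmForm x y u v) :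
    LcmForm y x v u := by
  rcases h with ⟨rfl, rfl⟩ | ⟨h, k, hu, hv⟩ | ⟨h, k, hu, hv⟩
  · exact .inl ⟨rfl, rfl⟩
  · exact .inr (.inl ⟨h.symm, k, hv, hu⟩)
  · exact .inr (.inr ⟨h.symm, k, hv, hu⟩)

/-- Garside's lemma for elements `u` of length less than `L`. -/
def GarsideBelow (n L : ℕ) : Prop := ∀ (x y : Fin n) (u v : BraidMonoid n),
  (len u).toAdd < L → gen x * u = gen y * v → LcmForm x y u v

/-- This and the next two lemmas compose the relations `x`–`z` and `z`–`y` through an intermediate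
first letter `z`. Cancelling `z` leaves an equation between shorter elements, to which `H` applies.
-/
theorem LcmForm.trans_far_far {L : ℕ} (H : GarsideBelow n L) {x y z : Fin n}
    {k k' : BraidMonoid n} (hk : (len k).toAdd < L) (hxz : Far x z) (hzy : Far z y)
    (h : gen x * k = gen y * k') : LcmForm x y (gen z * k) (gen z * k') := by
  rcases H _ _ _ _ hk h with ⟨rfl, rfl⟩ | ⟨hxy, m, rfl, rfl⟩ | ⟨hxy, m, rfl, rfl⟩
  · exact .inl ⟨rfl, rfl⟩
  · exact .inr (.inl ⟨hxy, gen z * m, gen_mul_comm_left hzy m, (gen_mul_comm_left hxz m).symm⟩)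
  · have h1 := gen_mul_comm_left hxz
    have h2 := gen_mul_comm_left hzy
    exact .inr (.inr ⟨hxy, gen z * m, by rw [h2, h1], by rw [← h1, h2]⟩)

theorem LcmForm.trans_far_adj {L : ℕ} (H : GarsideBelow n L) {x y z : Fin n}
    {k k' : BraidMonoid n} (hk : (len k).toAdd < L) (hk' : (len k').toAdd + 1 < L)
    (hxz : Far x z) (hzy : Adj z y)
    (h : gen x * k = gen y * (gen z * k')) :
    LcmForm x y (gen z * k) (gen z * (gen y * k')) := by
  have cxz := gen_mul_comm_left hxz
  have bzy := gen_braid_left hzy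
  have hzx := hxz.symm
  rcases H _ _ _ _ hk h with ⟨rfl, rfl⟩ | ⟨hxy, m, rfl, hm⟩ | ⟨hxy, m, rfl, hm⟩
  · unfold Far Adj at *; omega
  · have cxy := gen_mul_comm_left hxy
    rcases H _ _ _ _ (by omega) hm with ⟨rfl, rfl⟩ | ⟨-, p, rfl, rfl⟩ | ⟨hzx', -⟩
    · unfold Far Adj at *; omega
    · refine .inr (.inl ⟨hxy, gen z * (gen y * p), ?_, ?_⟩)
      · rw [bzy]
      · rw [← cxy, cxz]
    · unfold Far Adj at *; omega
  · have bxy := gen_braid_left hxy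
    rcases H _ _ _ _ (by omega) hm with ⟨rfl, rfl⟩ | ⟨-, p, rfl, hp⟩ | ⟨hzx', -⟩
    · unfold Far Adj at *; omega
    · simp only [len_gen_mul] at hk
      rcases H _ _ _ _ (by omega) hp with ⟨rfl, rfl⟩ | ⟨hyz, -⟩ | ⟨-, q, rfl, rfl⟩
      · unfold Far Adj at *; omega
      · unfold Far Adj at *; omega
      -- Here `y` lies between `x` and `z`, and the common multiple is the six-letter fundamental
      -- element on these three generators, times `q`.
      · refine .inr (.inr ⟨hxy, gen z * (gen y * (gen x * q)), ?_, ?_⟩)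
        · grind
        · grind
    · unfold Far Adj at *; omega

theorem LcmForm.trans_adj_adj {L : ℕ} (H : GarsideBelow n L) {x y z : Fin n}
    {k k' : BraidMonoid n} (hk : (len k).toAdd + 1 < L) (hk' : (len k').toAdd + 1 < L)
    (hxz : Adj x z) (hzy : Adj z y)
    (h : gen x * (gen z * k) = gen y * (gen z * k')) :
    LcmForm x y (gen z * (gen x * k)) (gen z * (gen y * k')) := by
  have bxz := gen_braid_left hxz
  have bzy := gen_braid_left hzy
  rcases H _ _ _ _ (by rw [len_gen_mul]; omega) h with ⟨rfl, e⟩ | ⟨hxy, m, hm, hm'⟩ | ⟨hxy, -⟩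
  -- Cancellation of `z` is itself an instance of the induction hypothesis.
  · rcases H _ _ _ _ (by omega) e with ⟨-, rfl⟩ | ⟨hzz, -⟩ | ⟨hzz, -⟩
    · exact .inl ⟨rfl, rfl⟩
    · unfold Far Adj at *; omega
    · unfold Far Adj at *; omega
  · have cxy := gen_mul_comm_left hxy
    rcases H _ _ _ _ (by omega) hm with ⟨rfl, -⟩ | ⟨hh, -⟩ | ⟨-, p, rfl, rfl⟩
    · unfold Far Adj at *; omega
    · unfold Far Adj at *; omega
    rcases H _ _ _ _ (by omega) hm' with ⟨rfl, -⟩ | ⟨hh, -⟩ | ⟨-, q, rfl, hq⟩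
    · unfold Far Adj at *; omega
    · unfold Far Adj at *; omega
    simp only [len_gen_mul] at hk hk'
    rcases H _ _ _ _ (by simp only [len_gen_mul]; omega) hq with ⟨-, hq⟩ | ⟨hh, -⟩ | ⟨hh, -⟩
    · rcases H _ _ _ _ (by omega) hq with ⟨rfl, -⟩ | ⟨-, r, rfl, rfl⟩ | ⟨hh, -⟩
      · unfold Far Adj at *; omega
      · refine .inr (.inl ⟨hxy, gen z * (gen y * (gen x * (gen z * r))), ?_, ?_⟩)
        · grind
        · grind
      · unfold Far Adj at *; omega
    · unfold Far Adj at *; omega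
    · unfold Far Adj at *; omega
  · unfold Far Adj at *; omega

theorem LcmForm.trans_far {L : ℕ} (H : GarsideBelow n L) {x y z : Fin n} {u k' : BraidMonoid n}
    (hL : (len u).toAdd = L) (h : LcmForm x z u (gen y * k')) (hzy : Far z y) :
    LcmForm x y u (gen z * k') := by
  rcases h with ⟨rfl, rfl⟩ | ⟨hxz, k, rfl, h⟩ | ⟨hxz, k, rfl, h⟩
  · exact .inr (.inl ⟨hzy, k', rfl, rfl⟩)
  · rw [len_gen_mul] at hL
    exact trans_far_far H (by omega) hxz hzy h.symm
  · have hl := congrArg (fun g => (len g).toAdd) h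
    simp only [len_gen_mul] at hL hl
    exact (trans_far_adj H (by omega) (by omega) hzy.symm hxz.symm h).symm

theorem LcmForm.trans_adj {L : ℕ} (H : GarsideBelow n L) {x y z : Fin n} {u k' : BraidMonoid n}
    (hL : (len u).toAdd = L) (hk' : (len k').toAdd + 2 = L)
    (h : LcmForm x z u (gen y * (gen z * k'))) (hzy : Adj z y) :
    LcmForm x y u (gen z * (gen y * k')) := by
  rcases h with ⟨rfl, rfl⟩ | ⟨hxz, k, rfl, h⟩ | ⟨hxz, k, rfl, h⟩
  · exact .inr (.inr ⟨hzy, k', rfl, rfl⟩)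
  · rw [len_gen_mul] at hL
    exact trans_far_adj H (by omega) (by omega) hxz hzy h.symm
  · simp only [len_gen_mul] at hL
    exact trans_adj_adj H (by omega) (by omega) hxz hzy h.symm

/-- Induction on the chain: a rewrite either keeps the first letter, leaving the value of the tail
unchanged, or acts at the head, where the gluing lemmas apply. -/
theorem lcmForm_of_reflTransGen {L : ℕ} (H : GarsideBelow n L) {x : Fin n} {u b : List (Fin n)}
    (hL : u.length = L) (h : Relation.ReflTransGen Step (x :: u) b) :
    ∃ y v, b = y :: v ∧ v.length = L ∧ LcmForm x y (eval u) (eval v) := by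
  induction h with
  | refl => exact ⟨x, u, rfl, hL, .inl ⟨rfl, rfl⟩⟩
  | tail _ hs ih =>
    obtain ⟨z, w, rfl, hw, hf⟩ := ih
    have hlen : ∀ (w : List (Fin n)), (len (eval w)).toAdd = w.length := fun w => by
      rw [len_eval]; rfl
    have hlu := hlen u
    generalize eval u = U at hf hlu
    generalize hb : z :: w = b at hs
    cases hs with
    | cons _ hs =>
      obtain ⟨rfl, rfl⟩ := List.cons.inj hb
      have := congrArg (fun g => (len g).toAdd) hs.eval_eq
      simp only [hlen] at this
      exact ⟨z, _, rfl, by omega, hs.eval_eq ▸ hf⟩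
    | head q hr =>
      cases hr with
      | comm z' y hzy =>
        obtain ⟨rfl, rfl⟩ := List.cons.inj hb
        refine ⟨y, z :: q, rfl, by simpa using hw, ?_⟩
        change LcmForm x z U (gen y * eval q) at hf
        change LcmForm x y U (gen z * eval q)
        exact hf.trans_far H (by omega) hzy
      | braid z' y hzy =>
        obtain ⟨rfl, rfl⟩ := List.cons.inj hb
        refine ⟨y, z :: y :: q, rfl, by simpa using hw, ?_⟩
        change LcmForm x z U (gen y * (gen z * eval q)) at hf
        change LcmForm x y U (gen z * (gen y * eval q))
        exact hf.trans_adj H (by omega) (by have := hlen q; simp at hw; omega) hzy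

theorem garsideBelow (L : ℕ) : GarsideBelow n L := by
  induction L with
  | zero => intro x y u v h; omega
  | succ L ih =>
    intro x y u v hu huv
    obtain ⟨u, rfl⟩ := exists_eval_eq u
    obtain ⟨v, rfl⟩ := exists_eval_eq v
    rcases Nat.lt_succ_iff_lt_or_eq.1 hu with hu | hu
    · exact ih _ _ _ _ hu huv
    · rw [len_eval, toAdd_ofAdd] at hu
      obtain ⟨y', v', hb, -, h⟩ :=
        lcmForm_of_reflTransGen ih hu (reflTransGen_step_of_eval_eq (u := x :: u) (v := y :: v) huv)
      obtain ⟨rfl, rfl⟩ := List.cons.inj hb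
      exact h

/-- **Garside's lemma.** -/
theorem lcmForm_of_gen_mul_eq {x y : Fin n} {u v : BraidMonoid n}
    (h : gen x * u = gen y * v) : LcmForm x y u v :=
  garsideBelow _ x y u v (Nat.lt_succ_self _) h

/-! ### Cancellation and left divisibility. -/

theorem gen_mul_left_cancel {x : Fin n} {u v : BraidMonoid n} (h : gen x * u = gen x * v) :
    u = v := by
  rcases lcmForm_of_gen_mul_eq h with ⟨-, h⟩ | ⟨h, -⟩ | ⟨h, -⟩
  · exact h
  · unfold Far at h; omega
  · unfold Adj at h; omega

theorem eval_mul_left_cancel (w : List (Fin n)) {u v : BraidMonoid n}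
    (h : eval w * u = eval w * v) : u = v := by
  induction w with
  | nil => simpa using h
  | cons x w ih =>
    rw [eval_cons, mul_assoc, mul_assoc] at h
    exact ih (gen_mul_left_cancel h)

theorem eval_dvd_of_mul_dvd_mul (w : List (Fin n)) {u v : BraidMonoid n}
    (h : eval w * u ∣ eval w * v) : u ∣ v := by
  obtain ⟨c, hc⟩ := h
  rw [mul_assoc] at hc
  exact ⟨c, eval_mul_left_cancel w hc⟩

theorem dvd_of_far {x y : Fin n} (hxy : Far x y) {t : BraidMonoid n} (h : gen x ∣ gen y * t) :
    gen x ∣ t := by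
  obtain ⟨c, hc⟩ := h
  rcases lcmForm_of_gen_mul_eq hc with ⟨rfl, h⟩ | ⟨h, k, rfl, rfl⟩ | ⟨h, -⟩
  · unfold Far at hxy; omega
  · exact dvd_mul_right _ _
  · unfold Far Adj at *; omega

theorem dvd_of_adj {x y : Fin n} (hxy : Adj x y) {t : BraidMonoid n} (h : gen x ∣ gen y * t) :
    gen x * gen y ∣ t := by
  obtain ⟨c, hc⟩ := h
  rcases lcmForm_of_gen_mul_eq hc with ⟨rfl, h⟩ | ⟨h, -⟩ | ⟨h, k, rfl, rfl⟩
  · unfold Adj at hxy; omega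
  · unfold Far Adj at *; omega
  · rw [← mul_assoc]
    exact dvd_mul_right _ _

theorem dvd_of_forall_far {x : Fin n} {w : List (Fin n)} (hw : ∀ y ∈ w, Far x y)
    {t : BraidMonoid n} (h : gen x ∣ eval w * t) : gen x ∣ t := by
  induction w with
  | nil => simpa using h
  | cons y w ih =>
    rw [List.forall_mem_cons] at hw
    rw [eval_cons, mul_assoc] at h
    exact ih hw.2 (dvd_of_far hw.1 h)

theorem gen_mul_eval_comm {x : Fin n} {w : List (Fin n)} (hw : ∀ y ∈ w, Far x y) :
    gen x * eval w = eval w * gen x := by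
  induction w with
  | nil => simp
  | cons y w ih =>
    rw [List.forall_mem_cons] at hw
    rw [eval_cons, ← mul_assoc, gen_mul_comm hw.1, mul_assoc, ih hw.2, mul_assoc]

/-! ### Descending words. -/

theorem mem_desc {i j : ℕ} {x : Fin n} : x ∈ desc n i j ↔ j ≤ (x : ℕ) + 1 ∧ (x : ℕ) + 1 ≤ i := by
  simp [desc, idx]

theorem desc_eq_nil {i j : ℕ} (h : i < j) : desc n i j = [] :=
  List.eq_nil_iff_forall_not_mem.2 fun x hx => by rw [mem_desc] at hx; omega

theorem desc_pairwise (i j : ℕ) : (desc n i j).Pairwise (· > ·) := by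
  refine List.Pairwise.filter _ ?_
  rw [List.pairwise_reverse]
  exact List.pairwise_lt_finRange n

theorem desc_cons {j : ℕ} (x : Fin n) (h : j ≤ (x : ℕ) + 1) :
    desc n ((x : ℕ) + 1) j = x :: desc n x j := by
  have hp : (x :: desc n x j).Pairwise (· > ·) := by
    refine List.pairwise_cons.2 ⟨fun y hy => ?_, desc_pairwise _ _⟩
    rw [mem_desc] at hy
    exact Fin.lt_def.2 (by omega)
  refine List.Perm.eq_of_pairwise (le := (· > ·)) (fun a b _ _ h₁ h₂ => absurd h₁ h₂.asymm)
    (desc_pairwise _ _) hp ?_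
  refine (List.perm_ext_iff_of_nodup ((desc_pairwise _ _).imp ne_of_gt) (hp.imp ne_of_gt)).2 ?_
  intro y
  rw [List.mem_cons, mem_desc, mem_desc, Fin.ext_iff]
  omega

theorem desc_succ {i j : ℕ} {x : Fin n} (hx : (x : ℕ) = i) (h : j ≤ i + 1) :
    desc n (i + 1) j = x :: desc n i j := by
  subst hx
  exact desc_cons x h

theorem desc_self {i : ℕ} {x : Fin n} (hx : (x : ℕ) + 1 = i) : desc n i i = [x] := by
  subst hx
  rw [desc_cons x le_rfl, desc_eq_nil (Nat.lt_succ_self _)]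

theorem far_of_mem_desc_of_lt {i j : ℕ} {x : Fin n} (h : (x : ℕ) + 2 < j) :
    ∀ z ∈ desc n i j, Far x z := fun z hz => by
  rw [mem_desc] at hz
  unfold Far
  omega

theorem far_of_mem_desc_of_gt {i j : ℕ} {x : Fin n} (h : i < x) :
    ∀ z ∈ desc n i j, Far x z := fun z hz => by
  rw [mem_desc] at hz
  unfold Far
  omega

theorem desc_append {i m j : ℕ} (hi : i ≤ n) (hm : m ≤ i) (hj : j ≤ m + 1) :
    desc n i j = desc n i (m + 1) ++ desc n m j := by
  induction i, hm using Nat.le_induction with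
  | base => rw [desc_eq_nil (Nat.lt_succ_self m), List.nil_append]
  | succ i hm ih =>
    rw [desc_succ (i := i) (x := ⟨i, hi⟩) rfl (by omega),
      desc_succ (i := i) (j := m + 1) (x := ⟨i, hi⟩) rfl (by omega), ih (by omega), List.cons_append]

/-- `a_i ⋯ a_j` read around the adjacent letters `a_{x+2} a_{x+1}`. -/
theorem desc_split {i j : ℕ} {x y : Fin n} (hxy : (y : ℕ) = x + 1) (hi : i ≤ n)
    (hyi : (y : ℕ) + 1 ≤ i) (hj : j ≤ (x : ℕ) + 1) :
    desc n i j = desc n i (y + 2) ++ y :: x :: desc n x j := by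
  rw [desc_append hi hyi (by omega), desc_cons y (by omega), hxy, desc_cons x hj]

/-- The letter `x` commutes with everything above `y`, the braid relation turns `x y x` into `y x
y`, and the last `y` commutes with everything below `x`. -/
theorem gen_mul_desc {i j : ℕ} {x y : Fin n} (hxy : (y : ℕ) = x + 1) (hi : i ≤ n)
    (hyi : (y : ℕ) + 1 ≤ i) (hj : j ≤ (x : ℕ) + 1) :
    gen x * eval (desc n i j) = eval (desc n i j) * gen y := by
  have h1 := gen_mul_eval_comm (x := x) (far_of_mem_desc_of_lt (i := i) (j := y + 2) (by omega))
  have h2 := gen_mul_eval_comm (x := y) (far_of_mem_desc_of_gt (i := x) (j := j) (by omega))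
  have h3 := gen_braid_left (x := x) (y := y) (Or.inl hxy.symm)
  rw [desc_split hxy hi hyi hj, eval_append, ← mul_assoc, h1]
  simp only [eval_cons y, eval_cons x, mul_assoc]
  rw [h3, ← h2]

theorem dvd_of_dvd_desc_mul {i j : ℕ} {x y : Fin n} (hxy : (y : ℕ) = x + 1) (hi : i ≤ n)
    (hyi : (y : ℕ) + 1 ≤ i) (hj : j ≤ (x : ℕ) + 1) {t : BraidMonoid n}
    (h : gen x ∣ eval (desc n i j) * t) : gen y ∣ t := by
  rw [desc_split hxy hi hyi hj, eval_append, mul_assoc] at h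
  have h := dvd_of_forall_far (far_of_mem_desc_of_lt (by omega)) h
  simp only [eval_cons y, eval_cons x, mul_assoc] at h
  have h := eval_dvd_of_mul_dvd_mul _ (dvd_of_adj (Or.inl hxy.symm) h)
  exact dvd_of_forall_far (far_of_mem_desc_of_gt (by omega)) h

theorem dvd_of_dvd_desc_mul_below {i j : ℕ} {x y : Fin n} (hxy : (y : ℕ) = x + 1) (hi : i ≤ n)
    (hyi : (y : ℕ) + 1 ≤ i) (hj : j = (y : ℕ) + 1) {t : BraidMonoid n}
    (h : gen x ∣ eval (desc n i j) * t) : gen x * gen y ∣ t := by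
  subst hj
  rw [desc_append hi hyi (by omega), desc_self rfl, eval_append, mul_assoc] at h
  exact dvd_of_adj (Or.inl hxy.symm) (dvd_of_forall_far (far_of_mem_desc_of_lt (by omega)) h)

/-! ### Reduced words and their smallest left divisor. -/

theorem IsReduced.of_infix {u v : List (Fin n)} (hv : IsReduced v) (h : u <:+: v) : IsReduced u :=
  fun l r hlr hl => hv l r hlr (hl.trans h)

theorem IsReduced.of_cons {x : Fin n} {v : List (Fin n)} (h : IsReduced (x :: v)) : IsReduced v :=
  h.of_infix (List.suffix_cons x v).isInfix

theorem IsReduced.le_succ {x y : Fin n} {v : List (Fin n)} (h : IsReduced (x :: y :: v)) :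
    (x : ℕ) ≤ y + 1 := by
  by_contra hc
  exact h _ _ (.comm x y (by simp only [idx]; omega)) (List.prefix_append [x, y] v).isInfix

/-- In every suffix of `v`, the first letter is the smallest generator dividing the suffix. -/
def HeadMin : List (Fin n) → Prop
  | [] => True
  | x :: v => (∀ y, gen y ∣ eval (x :: v) → x ≤ y) ∧ HeadMin v

theorem eval_ne_of_dvd_nil {x : Fin n} : ¬ gen x ∣ eval ([] : List (Fin n)) := by
  rintro ⟨c, hc⟩
  have := congrArg (fun g => (len g).toAdd) hc
  simp only [len_gen_mul] at this
  simp at this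

theorem exists_cons_of_dvd {x : Fin n} {v : List (Fin n)} (hm : HeadMin v) (h : gen x ∣ eval v) :
    ∃ z t, v = z :: t ∧ z ≤ x := by
  cases v with
  | nil => exact (eval_ne_of_dvd_nil h).elim
  | cons z t => exact ⟨z, t, rfl, hm.1 x h⟩

/-- If the first letter of a reduced word is the `i`-th and `a_i ⋯ a_j` divides the word, then the
word begins with `a_i ⋯ a_j`. -/
theorem desc_prefix {i j : ℕ} (hi : i ≤ n) {s : List (Fin n)} (hs : IsReduced s) (hm : HeadMin s)
    (hh : ∀ x ∈ s.head?, (x : ℕ) + 1 ≥ i) (h : eval (desc n i j) ∣ eval s) :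
    desc n i j <+: s := by
  induction i generalizing s with
  | zero =>
    rw [List.eq_nil_iff_forall_not_mem.2 fun x (hx : x ∈ desc n 0 j) => by
      rw [mem_desc] at hx; omega]
    exact List.nil_prefix
  | succ i ih =>
    by_cases hj : j ≤ i + 1
    · have hd := desc_cons (⟨i, hi⟩ : Fin n) hj
      simp only at hd
      rw [hd] at h ⊢
      rw [eval_cons] at h
      obtain ⟨z, t, rfl, hz⟩ := exists_cons_of_dvd hm ((dvd_mul_right _ _).trans h)
      -- `HeadMin` bounds the head from above and `hh` from below; for the next letter the lower
      -- bound comes from the absence of `a_s a_k` with `s - k ≥ 2`.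
      have := hh z rfl
      obtain rfl : z = ⟨i, hi⟩ := le_antisymm hz (by rw [Fin.le_def]; simpa using this)
      rw [eval_cons] at h
      refine List.cons_prefix_cons.2 ⟨rfl, ih (by omega) hs.of_cons hm.2 ?_
        (eval_dvd_of_mul_dvd_mul _ h)⟩
      intro x hx
      cases t with
      | nil => simp at hx
      | cons y t =>
        cases hx
        exact hs.le_succ
    · rw [desc_eq_nil (by omega)]
      exact List.nil_prefix

/-- Letters before `a_{i+1}` go into `W`. Cancelling one of index at least `j` preserves the divisor
`a_{i+1} ⋯ a_j`; cancelling `a_{j-1}` lengthens it to `a_{i+1} ⋯ a_{j-1}`. The preceding letter `q`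
excludes lower ones. -/
theorem exists_chain_prefix {i j : ℕ} (hi : i + 1 ≤ n) (hj : 1 ≤ j) (hji : j ≤ i)
    {q : Fin n} (hq : j ≤ (q : ℕ) + 1) {s : List (Fin n)}
    (hs : IsReduced (q :: s)) (hm : HeadMin s) (h : eval (desc n (i + 1) j) ∣ eval s) :
    ∃ j' W, 1 ≤ j' ∧ j' ≤ j ∧ IsWordIn j' i W ∧ W ++ desc n (i + 1) j' <+: s := by
  induction s generalizing j q with
  | nil =>
    have hd := desc_succ (i := i) (x := ⟨i, hi⟩) (j := j) rfl (by omega)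
    rw [hd, eval_cons] at h
    exact (eval_ne_of_dvd_nil ((dvd_mul_right _ _).trans h)).elim
  | cons z s ih =>
    have hd := desc_succ (i := i) (x := ⟨i, hi⟩) (j := j) rfl (by omega)
    have hz : z ≤ ⟨i, hi⟩ := hm.1 _ ((dvd_mul_right _ _).trans (by rwa [hd, eval_cons] at h))
    rw [Fin.le_def] at hz
    simp only at hz
    have hqz := hs.le_succ
    by_cases hzi : (z : ℕ) = i
    · refine ⟨j, [], hj, le_rfl, by simp [IsWordIn], desc_prefix hi hs.of_cons hm ?_ h⟩
      rintro x hx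
      cases hx
      omega
    · obtain ⟨c, hc⟩ := h
      rw [eval_cons] at hc
      obtain ⟨y, hy⟩ : ∃ y : Fin n, (y : ℕ) = z + 1 := ⟨⟨z + 1, by omega⟩, rfl⟩
      by_cases hzj : j ≤ (z : ℕ) + 1
      · obtain ⟨c, rfl⟩ := dvd_of_dvd_desc_mul hy hi (by omega) hzj ⟨_, hc.symm⟩
        rw [← mul_assoc, ← gen_mul_desc hy hi (by omega) hzj, mul_assoc] at hc
        obtain ⟨j', W, h1, h2, h3, h4⟩ := ih hj hji hzj hs.of_cons hm.2
          ⟨c, gen_mul_left_cancel hc⟩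
        refine ⟨j', z :: W, h1, h2, ?_, List.cons_prefix_cons.2 ⟨rfl, h4⟩⟩
        exact List.forall_mem_cons.2 ⟨by simp only [idx]; omega, h3⟩
      · obtain ⟨c, rfl⟩ := dvd_of_dvd_desc_mul_below hy hi (by omega) (j := j) (by omega) ⟨_, hc.symm⟩
        have hjz : j = (z : ℕ) + 1 + 1 := by omega
        have hd' := desc_append (i := i + 1) (m := z + 1) (j := z + 1) hi (by omega) (by omega)
        rw [desc_self rfl, ← hjz] at hd'
        have he : eval (desc n (i + 1) (z + 1)) = eval (desc n (i + 1) j) * gen z := by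
          rw [hd', eval_append]; rfl
        rw [mul_assoc (gen z), ← mul_assoc, ← he, ← mul_assoc,
          ← gen_mul_desc hy hi (by omega) le_rfl, mul_assoc] at hc
        obtain ⟨j', W, h1, h2, h3, h4⟩ := ih (j := z + 1) (by omega) (by omega) le_rfl hs.of_cons hm.2
          ⟨c, gen_mul_left_cancel hc⟩
        refine ⟨j', z :: W, h1, by omega, ?_, List.cons_prefix_cons.2 ⟨rfl, h4⟩⟩
        exact List.forall_mem_cons.2 ⟨by simp only [idx]; omega, h3⟩

/-- A reduced word divisible by `a_{i+1}` begins with `V W a_{i+1} ⋯ a_j` with `V`, `W` as in the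
relations of the Gröbner–Shirshov basis. -/
theorem exists_basis_prefix {i : ℕ} {x : Fin n} (hx : (x : ℕ) = i) {s : List (Fin n)}
    (hs : IsReduced s) (hm : HeadMin s) (h : gen x ∣ eval s) :
    ∃ j V W, 1 ≤ j ∧ j ≤ i + 1 ∧ IsWordIn 1 (i - 1) V ∧ IsWordIn j i W ∧ EmptyOrBeginsWith i W ∧
      V ++ W ++ desc n (i + 1) j <+: s := by
  induction s with
  | nil => exact (eval_ne_of_dvd_nil h).elim
  | cons z s ih =>
    have hz := hm.1 _ h
    rw [Fin.le_def] at hz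
    -- The head is `a_{i+1}` itself (take `j = i + 1`), or `a_i`, which opens `W`, or a lower
    -- letter, which joins `V`.
    rcases (by omega : (z : ℕ) = i ∨ (z : ℕ) + 1 = i ∨ (z : ℕ) + 2 ≤ i) with hzi | hzi | hzi
    · refine ⟨i + 1, [], [], by omega, le_rfl, by simp [IsWordIn], by simp [IsWordIn],
        by simp [EmptyOrBeginsWith], ?_⟩
      rw [desc_self (x := z) (by omega)]
      exact List.prefix_append [z] s
    · rw [eval_cons] at h
      have h := dvd_of_adj (Or.inr (hzi.trans hx.symm)) h
      have hd := desc_succ hx (j := i) (by omega)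
      rw [desc_self hzi] at hd
      change eval [x, z] ∣ _ at h
      rw [← hd] at h
      obtain ⟨j, W, h1, h2, h3, h4⟩ :=
        exists_chain_prefix (by omega) (by omega) le_rfl hzi.ge hs hm.2 h
      refine ⟨j, [], z :: W, h1, by omega, by simp [IsWordIn], ?_, ?_,
        List.cons_prefix_cons.2 ⟨rfl, h4⟩⟩
      · exact List.forall_mem_cons.2 ⟨by simp only [idx]; omega, h3⟩
      · intro x hx
        cases hx
        exact hzi
    · rw [eval_cons] at h
      obtain ⟨j, V, W, h1, h2, h3, h4, h5, h6⟩ :=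
        ih hs.of_cons hm.2 (dvd_of_far (Or.inr (by omega)) h)
      refine ⟨j, z :: V, W, h1, h2, ?_, h4, h5, List.cons_prefix_cons.2 ⟨rfl, h6⟩⟩
      exact List.forall_mem_cons.2 ⟨by simp only [idx]; omega, h3⟩

/-- A smaller divisor `y` far from `x` also divides `v`, so `v` begins with a letter too low to
follow `x`. If `y` is adjacent to `x`, then `v` must begin with `y`, and `exists_basis_prefix`
completes `x y` to a leading word. -/
theorem IsReduced.headMin {v : List (Fin n)} (hv : IsReduced v) : HeadMin v := by
  induction v with
  | nil => trivial
  | cons x v ih =>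
    have hm := ih hv.of_cons
    refine ⟨fun y hy => ?_, hm⟩
    by_contra hxy
    rw [Fin.le_def, not_le] at hxy
    rw [eval_cons] at hy
    by_cases hyx : (y : ℕ) + 1 = x
    · have h := dvd_of_adj (Or.inl hyx) hy
      obtain ⟨z, t, rfl, hz⟩ := exists_cons_of_dvd hm ((dvd_mul_right _ _).trans h)
      rw [Fin.le_def] at hz
      have := hv.le_succ
      obtain rfl : z = y := Fin.ext (by omega)
      rw [eval_cons z t] at h
      obtain ⟨j, V, W, h1, h2, h3, h4, h5, r, rfl⟩ :=
        exists_basis_prefix (x := x) rfl hv.of_cons.of_cons hm.2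
          (eval_dvd_of_mul_dvd_mul [z] h)
      have hb := BasisRel.chain (n := n) x j V W (by omega) x.2 h1 h2 h3 h4 h5
      rw [desc_succ (j := x) rfl (by omega), desc_self hyx] at hb
      refine hv _ _ hb (List.IsPrefix.isInfix ⟨r, ?_⟩)
      simp
    · have h := dvd_of_far (Or.inl (by omega)) hy
      obtain ⟨z, t, rfl, hz⟩ := exists_cons_of_dvd hm h
      rw [Fin.le_def] at hz
      have := hv.le_succ
      omega

theorem isWordIn_desc {i j : ℕ} : IsWordIn j i (desc n i j) := fun _ hx => mem_desc.1 hx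

/-- Otherwise `z = a_{i+1}` with `i ≥ 1`, and the tail `a_{i+1} a_i ⋯ a_1` of `Λ_k` followed by `z`
is a leading word with `V = a_{i-1} ⋯ a_1` and `W` empty. -/
theorem IsReduced.eq_zero_of_Lam_append {k : ℕ} (hk : k ≤ n) {z : Fin n} {s : List (Fin n)}
    (hz : (z : ℕ) + 1 ≤ k) (h : IsReduced (Lam n k ++ z :: s)) : (z : ℕ) = 0 := by
  by_contra hz0
  obtain ⟨x, hx⟩ : ∃ x : Fin n, (z : ℕ) = x + 1 := ⟨⟨z - 1, by omega⟩, by simp only; omega⟩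
  have hV : IsWordIn 1 ((z : ℕ) - 1) (desc n x 1) := by
    rw [hx]
    exact isWordIn_desc
  have hb := BasisRel.chain (n := n) z (z + 1) (desc n x 1) [] (by omega) z.2 (by omega) le_rfl hV
    (by simp [IsWordIn]) (by simp [EmptyOrBeginsWith])
  rw [desc_succ (x := z) (j := z) rfl (by omega), desc_self hx.symm, desc_self rfl] at hb
  refine h _ _ hb ⟨desc n k (z + 2), s, ?_⟩
  rw [Lam, desc_split (i := k) (j := 1) hx hk hz (by omega)]
  simp only [List.append_assoc, List.cons_append, List.nil_append]

/-! ### Extracting the factors of `Δ` from a reduced word. -/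

/-- The product word `Λ_{k+1} ⋯ Λ_{k+m}`. -/
def LamProd (n k m : ℕ) : List (Fin n) := (List.range' k m).flatMap fun l => Lam n (l + 1)

theorem LamProd_succ (k m : ℕ) : LamProd n k (m + 1) = Lam n (k + 1) ++ LamProd n (k + 1) m := by
  simp [LamProd, List.range'_succ]

theorem LamProd_zero (m : ℕ) :
    LamProd n 0 m = (List.range m).flatMap fun l => Lam n (l + 1) := by
  rw [LamProd, ← List.range_eq_range']

/-- If `a_z` with `z ≤ k` divides `Λ_{k+1} ⋯ Λ_{k+m} t`, then the quotient is again divisible by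
`Λ_{k+1} ⋯ Λ_{k+m}`. -/
theorem exists_eq_gen_mul_LamProd {k m : ℕ} (hkm : k + m ≤ n) {z : Fin n} (hz : (z : ℕ) + 1 ≤ k)
    {t : BraidMonoid n} (h : gen z ∣ eval (LamProd n k m) * t) :
    ∃ r, eval (LamProd n k m) * t = gen z * (eval (LamProd n k m) * r) := by
  induction m generalizing k z t with
  | zero => simpa [LamProd, dvd_def] using h
  | succ m ih =>
    obtain ⟨y, hy⟩ : ∃ y : Fin n, (y : ℕ) = z + 1 := ⟨⟨z + 1, by omega⟩, rfl⟩
    rw [LamProd_succ, eval_append, mul_assoc] at h ⊢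
    have h := dvd_of_dvd_desc_mul hy (by omega) (by omega) (by omega) h
    obtain ⟨r, hr⟩ := ih (by omega) (by omega) h
    refine ⟨r, ?_⟩
    rw [hr, ← mul_assoc, Lam, ← gen_mul_desc hy (by omega) (by omega) (by omega)]
    simp only [mul_assoc]

theorem exists_Lam_prefix {k m : ℕ} (hkm : k + (m + 1) ≤ n) {s : List (Fin n)} (hs : IsReduced s)
    (h : eval (LamProd n k (m + 1)) ∣ eval s) :
    ∃ V s', s = V ++ Lam n (k + 1) ++ s' ∧ IsWordIn 1 k V ∧ eval (LamProd n (k + 1) m) ∣ eval s' := by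
  have hd : Lam n (k + 1) = (⟨k, by omega⟩ : Fin n) :: Lam n k := desc_succ rfl (by omega)
  have hdvd : eval (Lam n (k + 1)) ∣ eval (LamProd n k (m + 1)) := by
    rw [LamProd_succ, eval_append]
    exact dvd_mul_right _ _
  have hg : gen (⟨k, by omega⟩ : Fin n) ∣ eval (Lam n (k + 1)) := by
    rw [hd, eval_cons]
    exact dvd_mul_right _ _
  induction s with
  | nil => exact (eval_ne_of_dvd_nil (hg.trans (hdvd.trans h))).elim
  | cons z s ih =>
    have hz : (z : ℕ) ≤ k := hs.headMin.1 _ (hg.trans (hdvd.trans h))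
    -- A head `a_{k+1}` starts all of `Λ_{k+1}` by `desc_prefix`; a lower head is moved into `V`.
    rcases hz.eq_or_lt with hz | hz
    · obtain ⟨s', hs'⟩ := desc_prefix (by omega) hs hs.headMin
        (fun x hx => by cases hx; omega) (hdvd.trans h)
      refine ⟨[], s', hs'.symm, by simp [IsWordIn], ?_⟩
      rw [← hs', LamProd_succ] at h
      exact eval_dvd_of_mul_dvd_mul _ h
    · obtain ⟨t, ht⟩ := h
      obtain ⟨r, hr⟩ := exists_eq_gen_mul_LamProd hkm (z := z) (by omega) ⟨eval s, ht.symm⟩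
      obtain ⟨V, s', rfl, hV, h'⟩ := ih hs.of_cons ⟨r, gen_mul_left_cancel (ht.trans hr)⟩
      exact ⟨z :: V, s', rfl, List.forall_mem_cons.2 ⟨by simp only [idx]; omega, hV⟩, h'⟩

theorem exists_garside_prefix {v : List (Fin n)} (hv : IsReduced v)
    (h : eval (Delta n) ∣ eval v) (m : ℕ) (hm : m + 1 ≤ n) :
    ∃ (V : ℕ → List (Fin n)) (s : List (Fin n)),
      (∀ i, 1 ≤ i → i ≤ m → IsWordIn 1 i (V i) ∧ EmptyOrBeginsWith 1 (V i)) ∧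
      v = (List.range m).flatMap (fun k => Lam n (k + 1) ++ V (k + 1)) ++ Lam n (m + 1) ++ s ∧
      eval (LamProd n (m + 1) (n - (m + 1))) ∣ eval s := by
  induction m with
  | zero =>
    rw [Delta, ← LamProd_zero] at h
    obtain ⟨k, rfl⟩ : ∃ k, n = k + 1 := ⟨n - 1, by omega⟩
    obtain ⟨V, s, rfl, hV, hs⟩ := exists_Lam_prefix (by omega) hv h
    obtain rfl : V = [] := List.eq_nil_iff_forall_not_mem.2 fun x hx => by
      have := hV x hx
      omega
    exact ⟨fun _ => [], s, fun i h1 h2 => by omega, by simp, hs⟩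
  | succ m ih =>
    obtain ⟨V, s, hV, rfl, hs⟩ := ih (by omega)
    have hr : IsReduced (Lam n (m + 1) ++ s) :=
      hv.of_infix (List.IsSuffix.isInfix ⟨_, (List.append_assoc _ _ _).symm⟩)
    obtain ⟨k, hk⟩ : ∃ k, n - (m + 1) = k + 1 := ⟨n - (m + 2), by omega⟩
    rw [hk] at hs
    obtain ⟨U, t, rfl, hU, ht⟩ :=
      exists_Lam_prefix (by omega) (hr.of_infix (List.suffix_append _ _).isInfix) hs
    have hU1 : EmptyOrBeginsWith 1 U := by
      intro x hx
      obtain ⟨U, rfl⟩ : ∃ U', U = x :: U' := by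
        cases U with
        | nil => simp at hx
        | cons y U => cases hx; exact ⟨U, rfl⟩
      rw [idx, hr.eq_zero_of_Lam_append (by omega) (hU x (by simp)).2]
    refine ⟨Function.update V (m + 1) U, t, fun i h1 h2 => ?_, ?_, ?_⟩
    · rcases h2.eq_or_lt with rfl | h2
      · simpa using ⟨hU, hU1⟩
      · rw [Function.update_of_ne (by omega)]
        exact hV i h1 (by omega)
    · have : (List.range m).flatMap (fun k => Lam n (k + 1) ++ Function.update V (m + 1) U (k + 1))
          = (List.range m).flatMap (fun k => Lam n (k + 1) ++ V (k + 1)) := by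
        refine List.flatMap_congr fun k hk => ?_
        rw [Function.update_of_ne (by have := List.mem_range.1 hk; omega)]
      simp [List.range_succ, this]
    · rwa [(by omega : n - (m + 1 + 1) = k)]

/-! ### Shifts and collecting `Δ` on the left. -/

theorem shift_eq_filterMap (m : ℕ) (w : List (Fin n)) : shift m w =
    w.filterMap fun x : Fin n => if h : (x : ℕ) + m < n then some ⟨(x : ℕ) + m, h⟩ else none := by
  rw [List.filterMap_eq_flatMap_toList]
  simp [shift, List.filterMap_eq_flatMap_toList, List.flatMap_assoc]

theorem shift_nil (m : ℕ) : shift m ([] : List (Fin n)) = [] := rfl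

theorem shift_append (m : ℕ) (u w : List (Fin n)) : shift m (u ++ w) = shift m u ++ shift m w := by
  simp only [shift_eq_filterMap, List.filterMap_append]

theorem shift_cons (m : ℕ) {x y : Fin n} (h : (y : ℕ) = x + m) (w : List (Fin n)) :
    shift m (x :: w) = y :: shift m w := by
  simp [shift_eq_filterMap, ← h]

theorem shift_shift (a b : ℕ) (w : List (Fin n)) : shift b (shift a w) = shift (a + b) w := by
  simp only [shift_eq_filterMap]
  rw [List.filterMap_filterMap]
  refine List.filterMap_congr fun x _ => ?_
  by_cases h : (x : ℕ) + a < n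
  · simp [h, add_assoc]
  · rw [dif_neg h, dif_neg (by omega)]
    rfl

theorem IsWordIn.shift {i j m : ℕ} {w : List (Fin n)} (h : IsWordIn j i w) :
    IsWordIn (j + m) (i + m) (shift m w) := by
  intro y hy
  rw [shift_eq_filterMap] at hy
  obtain ⟨x, hx, hxy⟩ := List.mem_filterMap.1 hy
  have := h x hx
  split_ifs at hxy with hlt
  obtain rfl := Option.some.inj hxy
  simp only [idx] at *
  omega

theorem shift_flatMap (m : ℕ) (l : List ℕ) (f : ℕ → List (Fin n)) :
    shift m (l.flatMap f) = l.flatMap fun k => shift m (f k) := by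
  simp only [shift_eq_filterMap, List.filterMap_flatMap]

theorem eval_mul_Lam {i : ℕ} (hi : i + 1 ≤ n) {w : List (Fin n)} (hw : IsWordIn 1 i w) :
    eval w * eval (Lam n (i + 1)) = eval (Lam n (i + 1)) * eval (shift 1 w) := by
  induction w with
  | nil => simp [shift_nil]
  | cons x w ih =>
    obtain ⟨hx, hw⟩ := List.forall_mem_cons.1 hw
    simp only [idx] at hx
    obtain ⟨y, hy⟩ : ∃ y : Fin n, (y : ℕ) = x + 1 := ⟨⟨x + 1, by omega⟩, rfl⟩
    rw [shift_cons 1 hy, eval_cons, eval_cons, mul_assoc, ih hw, ← mul_assoc, ← mul_assoc, Lam,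
      gen_mul_desc hy hi (by omega) (by omega)]

theorem eval_garside_prefix {V : ℕ → List (Fin n)} (m : ℕ) (hm : m + 1 ≤ n)
    (hV : ∀ i, 1 ≤ i → i ≤ m → IsWordIn 1 i (V i)) :
    eval ((List.range m).flatMap (fun k => Lam n (k + 1) ++ V (k + 1)) ++ Lam n (m + 1)) =
      eval ((List.range (m + 1)).flatMap (fun k => Lam n (k + 1)) ++
        (List.range m).flatMap fun k => shift (m - k) (V (k + 1))) := by
  induction m with
  | zero => simp
  | succ m ih =>
    have ih := ih (by omega) fun i h1 h2 => hV i h1 (by omega)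
    -- `S` is all that stands between the collected `Λ`s and `Λ_{m+2}`; its letters have index at
    -- most `m + 1`, so it crosses `Λ_{m+2}` as a single word.
    set S := ((List.range m).flatMap fun k => shift (m - k) (V (k + 1))) ++ V (m + 1) with hS
    have hSw : IsWordIn 1 (m + 1) S := by
      intro x hx
      rcases List.mem_append.1 hx with hx | hx
      · obtain ⟨k, hk, hx⟩ := List.mem_flatMap.1 hx
        rw [List.mem_range] at hk
        have := (hV (k + 1) (by omega) (by omega)).shift (m := m - k) x hx
        omega
      · exact hV _ (by omega) le_rfl x hx
    have hS1 : shift 1 S = (List.range (m + 1)).flatMap fun k => shift (m + 1 - k) (V (k + 1)) := by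
      have : ∀ k ∈ List.range m, shift 1 (shift (m - k) (V (k + 1))) =
          shift (m + 1 - k) (V (k + 1)) := by
        intro k hk
        rw [List.mem_range] at hk
        rw [shift_shift, (by omega : m - k + 1 = m + 1 - k)]
      rw [hS, List.range_succ, List.flatMap_append, ← List.flatMap_congr this, ← shift_flatMap,
        shift_append, List.flatMap_singleton, Nat.add_sub_cancel_left]
    have hD : (List.range (m + 1 + 1)).flatMap (fun k => Lam n (k + 1)) =
        (List.range (m + 1)).flatMap (fun k => Lam n (k + 1)) ++ Lam n (m + 1 + 1) := by
      rw [List.range_succ (n := m + 1), List.flatMap_append, List.flatMap_singleton]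
    rw [← hS1, hD, eval_append _ (shift 1 S), eval_append _ (Lam n (m + 1 + 1)),
      eval_append _ (Lam n (m + 1 + 1)), mul_assoc, ← eval_mul_Lam hm hSw, hS, ← mul_assoc,
      eval_append _ (V (m + 1)), ← mul_assoc, ← eval_append _ (List.flatMap _ _), ← ih,
      List.range_succ (n := m), List.flatMap_append, List.flatMap_singleton, ← List.append_assoc, ← eval_append]
    rfl

theorem HasGarsideForm.eval_eq (hn : 1 ≤ n) {v : List (Fin n)} {V : ℕ → List (Fin n)}
    {u : List (Fin n)} (h : HasGarsideForm v V u) :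
    eval v = eval (Delta n ++
      (List.range (n - 1)).flatMap (fun k => shift (n - (k + 1)) (V (k + 1))) ++ u) := by
  obtain ⟨hV, rfl⟩ := h
  obtain ⟨m, rfl⟩ : ∃ m, n = m + 1 := ⟨n - 1, by omega⟩
  rw [eval_append _ u, eval_append _ u]
  simpa [Delta] using congrArg (· * eval u)
    (eval_garside_prefix m le_rfl fun i h1 h2 => (hV i h1 h2).1)

theorem beginsWithDelta_iff_dvd {v : List (Fin n)} :
    BeginsWithDelta v ↔ eval (Delta n) ∣ eval v := by
  constructor
  · rintro ⟨w, hw⟩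
    exact ⟨eval w, hw⟩
  · rintro ⟨g, hg⟩
    obtain ⟨w, rfl⟩ := exists_eval_eq g
    exact ⟨w, hg⟩

end BraidSemigroup

theorem mainTheorem3 (n : ℕ) (hn : 1 ≤ n) (v : List (Fin n))
    (hv : BraidSemigroup.IsReduced v) :
    (BraidSemigroup.BeginsWithDelta v ↔
      ∃ (V : ℕ → List (Fin n)) (u : List (Fin n)), BraidSemigroup.HasGarsideForm v V u) ∧
    ∀ (V : ℕ → List (Fin n)) (u : List (Fin n)), BraidSemigroup.HasGarsideForm v V u →
      BraidSemigroup.eval v =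
        BraidSemigroup.eval
          (BraidSemigroup.Delta n ++
            (List.range (n - 1)).flatMap
              (fun k => BraidSemigroup.shift (n - (k + 1)) (V (k + 1))) ++ u) := by
  refine ⟨⟨fun h => ?_, ?_⟩, fun V u h => h.eval_eq hn⟩
  · obtain ⟨V, u, hV, rfl, -⟩ := BraidSemigroup.exists_garside_prefix hv
      (BraidSemigroup.beginsWithDelta_iff_dvd.1 h) (n - 1) (by omega)
    refine ⟨V, u, hV, ?_⟩
    rw [Nat.sub_add_cancel hn]
  · rintro ⟨V, u, h⟩
    exact ⟨_, (h.eval_eq hn).trans (by rw [List.append_assoc])⟩
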